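/- Let $m\ge 2$ and let $\mathbb{R}_m=C\ell_{0,m}$ be the real Clifford algebra with generators $e_1,\dots,e_m$, where $e_j^2=-1$ and $e_ie_j=-e_je_i$ for $i\ne j$, with the Euclidean topology of $\mathbb{R}_m\cong\mathbb{R}^{2^m}$. Identify $\mathbb{R}^{m+1}$ with the subspace of paravectors $x=x_0+\sum_{j=1}^m x_je_j$ of $\mathbb{R}_m$, write $\mathrm{Im}(x)=\sum_{j=1}^m x_je_j$ and $|\mathrm{Im}(x)|=(\sum_{j=1}^m x_j^2)^{1/2}$, and let $\mathbb{S}^{m-1}=\{I\in\mathbb{R}^{m+1}: I^2=-1\}$. Let $\Omega\subseteq\mathbb{R}^{m+1}$ be a non-empty connected open set with $\Omega\cap\mathbb{R}\neq\emptyset$ that is circular, i.e. $\Omega=\{\alpha+I\beta:\alpha,\beta\in\mathbb{R},\ \alpha+i\beta\in E,\ I\in\mathbb{S}^{m-1}\}$ for some $E\subseteq\mathbb{C}$. Put $\Omega_*=\Omega\setminus\mathbb{R}$ and, for $f:\Omega\to\mathbb{R}_m$, let $f_*=f|_{\Omega_*}$. Classes $\mathscr{C}^1$ and $\mathscr{C}^\omega$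 (real analytic) are meant in the real sense. Let $\mathcal{SM}(\Omega,\mathbb{R}_m)$ be the set of slice monogenic functions, i.e. of those $f\in\mathscr{C}^1(\Omega,\mathbb{R}_m)$ such that for every $I\in\mathbb{S}^{m-1}$ $$\tfrac12\Big(\frac{\partial}{\partial\alpha}+I\frac{\partial}{\partial\beta}\Big)f(\alpha+I\beta)=0\qquad\text{whenever }\alpha,\beta\in\mathbb{R},\ \alpha+I\beta\in\Omega .$$ Define $\overline{\vartheta}_m:\mathscr{C}^1(\Omega_*,\mathbb{R}_m)\to\mathscr{C}^0(\Omega_*,\mathbb{R}_m)$ and $G_m:\mathscr{C}^1(\Omega,\mathbb{R}_m)\to\mathscr{C}^0(\Omega,\mathbb{R}_m)$ by $$\overline{\vartheta}_m=\frac12\Big(\frac{\partial}{\partial x_0}+\frac{\mathrm{Im}(x)}{|\mathrm{Im}(x)|^2}\sum_{h=1}^m x_h\frac{\partial}{\partial x_h}\Big),\qquad G_m=|\mathrm{Im}(x)|^2\frac{\partial}{\partial x_0}+\mathrm{Im}(x)\sum_{h=1}^m x_h\frac{\partial}{\partial x_h},$$ with multiplication by $\mathrm{Im}(x)$ and $I$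 from the left. Then $$\mathcal{SM}(\Omega,\mathbb{R}_m)=\{f\in\mathscr{C}^1(\Omega,\mathbb{R}_m): f_*\in\ker(\overline{\vartheta}_m)\}=\ker(G_m)\subseteq\mathscr{C}^\omega(\Omega,\mathbb{R}_m).$$ -/

import Mathlib

open scoped ContDiff

noncomputable section

namespace SliceMono

section CliffordAlgebraRm

/-- The negative definite quadratic form `v ↦ -(v₁² + ⋯ + vₘ²)` on `ℝᵐ`. -/
def negSq (m : ℕ) : QuadraticForm ℝ (Fin m → ℝ) :=
  QuadraticMap.weightedSumSquares ℝ (fun _ : Fin m => (-1 : ℝ))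

/-- The Clifford algebra `ℝₘ = Cℓ(0,m)`: `eⱼ² = -1` and `eᵢ eⱼ = - eⱼ eᵢ` for `i ≠ j`. -/
abbrev Rm (m : ℕ) : Type := CliffordAlgebra (negSq m)

/-- The generator `eⱼ` of `ℝₘ`. -/
def gen (m : ℕ) (j : Fin m) : Rm m := CliffordAlgebra.ι (negSq m) (Pi.single j 1)

/-- The standard real vector basis `(e_K)` of `ℝₘ`, indexed by the subsets `K` of `{1,…,m}`.
Mathlib provides the corresponding basis of the exterior algebra; `stdBasis_apply` below says that
its transport to `ℝₘ` consists of the ordered products `e_K` of generators. -/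
def stdBasis (m : ℕ) : Module.Basis (Finset (Fin m)) ℝ (Rm m) :=
  (Pi.basisFun ℝ (Fin m)).ExteriorAlgebra.map (CliffordAlgebra.equivExterior (negSq m)).symm

theorem contractLeft_prod (m : ℕ) (d : Module.Dual ℝ (Fin m → ℝ)) (L : List (Fin m))
    (h : ∀ i ∈ L, d (Pi.single i 1) = 0) :
    CliffordAlgebra.contractLeft d
      ((L.map fun i => ExteriorAlgebra.ι ℝ (Pi.single i (1 : ℝ) : Fin m → ℝ)).prod) = 0 := by
  induction L with
  | nil => simp
  | cons a L ih =>
    rw [List.map_cons, List.prod_cons]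
    erw [CliffordAlgebra.contractLeft_ι_mul]
    rw [ih (fun i hi => h i (List.mem_cons_of_mem _ hi)), h a List.mem_cons_self]
    simp

theorem equivExterior_prod (m : ℕ) (L : List (Fin m)) (hL : L.Nodup) :
    CliffordAlgebra.equivExterior (negSq m) ((L.map (gen m)).prod) =
      (L.map fun i => ExteriorAlgebra.ι ℝ (Pi.single i (1 : ℝ) : Fin m → ℝ)).prod := by
  induction L with
  | nil => simp [CliffordAlgebra.equivExterior]
  | cons a L ih =>
    rw [List.nodup_cons] at hL
    have ih := ih hL.2
    rw [List.map_cons, List.prod_cons, List.map_cons, List.prod_cons]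
    simp only [CliffordAlgebra.equivExterior, CliffordAlgebra.changeFormEquiv_apply] at ih ⊢
    rw [gen, CliffordAlgebra.changeForm_ι_mul, ih]
    erw [contractLeft_prod, sub_zero]
    intro i hi
    have : a ≠ i := fun h => hL.1 (h ▸ hi)
    rw [QuadraticMap.associated_apply]
    simp [negSq, QuadraticMap.weightedSumSquares_apply, Pi.single_apply, this, this.symm,
      mul_add, Finset.sum_add_distrib]

/-- `e_K = e_{k₁} ⋯ e_{kₛ}` if `K = {k₁ < ⋯ < kₛ}`; in particular `e_∅ = 1`. -/
theorem stdBasis_apply (m : ℕ) (K : Finset (Fin m)) :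
    stdBasis m K = (K.sort.map (gen m)).prod := by
  rw [stdBasis, Module.Basis.map_apply, LinearEquiv.symm_apply_eq,
    equivExterior_prod m _ (K.sort_nodup _), ExteriorAlgebra.basis_apply_ofCard _ rfl,
    ExteriorAlgebra.ιMulti_family, ExteriorAlgebra.ιMulti_apply,
    ← Finset.listMap_orderEmbOfFin_finRange K rfl, List.map_map, List.ofFn_eq_map]
  congr 1
  apply List.map_congr_left
  intro i _
  simp [Set.powersetCard.ofFinEmbEquiv_symm_apply]

/-- Coordinates with respect to the standard basis, `ℝₘ ≃ ℝ^(2^m)`. -/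
def coords (m : ℕ) : Rm m ≃ₗ[ℝ] EuclideanSpace ℝ (Finset (Fin m)) :=
  (stdBasis m).equivFun ≪≫ₗ (WithLp.linearEquiv 2 ℝ (Finset (Fin m) → ℝ)).symm

/-- The Euclidean norm of `ℝₘ = ℝ^(2^m)`. -/
instance instNormedAddCommGroupRm (m : ℕ) : NormedAddCommGroup (Rm m) :=
  NormedAddCommGroup.induced (Rm m) (EuclideanSpace ℝ (Finset (Fin m))) (coords m)
    (coords m).injective

instance instNormedSpaceRm (m : ℕ) : NormedSpace ℝ (Rm m) :=
  NormedSpace.induced ℝ (Rm m) (EuclideanSpace ℝ (Finset (Fin m))) (coords m)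

end CliffordAlgebraRm

section Paravectors

/-- The space `ℝ^(m+1)` of paravectors `x = x₀ + x₁ e₁ + ⋯ + xₘ eₘ`, given by their coordinates
and identified with a subspace of `ℝₘ` through `incl`. -/
abbrev Paravector (m : ℕ) : Type := EuclideanSpace ℝ (Fin (m + 1))

/-- The coordinate vectors of `ℝ^(m+1)`. -/
def e (m : ℕ) (h : Fin (m + 1)) : Paravector m := EuclideanSpace.single h 1

/-- The inclusion `ℝ^(m+1) ⊆ ℝₘ`, `x ↦ x₀ + ∑ⱼ xⱼ eⱼ`. -/
def incl (m : ℕ) : Paravector m →ₗ[ℝ] Rm m where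
  toFun x := x 0 • (1 : Rm m) + ∑ j : Fin m, x j.succ • gen m j
  map_add' x y := by
    simp only [PiLp.add_apply, add_smul, Finset.sum_add_distrib]
    abel
  map_smul' c x := by
    simp only [PiLp.smul_apply, smul_eq_mul, mul_smul, Finset.smul_sum, smul_add, RingHom.id_apply]

/-- The imaginary part `Im(x) = x₁ e₁ + ⋯ + xₘ eₘ` of a paravector. -/
def im {m : ℕ} (x : Paravector m) : Paravector m := x - x 0 • e m 0

/-- The copy of `ℝ` in `ℝ^(m+1)`. -/
def realAxis (m : ℕ) : Set (Paravector m) := Set.range fun t : ℝ => t • e m 0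

/-- The sphere `𝕊^(m-1)` of paravector imaginary units. -/
def imUnits (m : ℕ) : Set (Paravector m) := {I | incl m I ^ 2 = -1}

/-- The map `φ_I : α + iβ ↦ α + Iβ`. -/
def phi {m : ℕ} (I : Paravector m) (z : ℂ) : Paravector m := z.re • e m 0 + z.im • I

/-- The circularization of `E ⊆ ℂ` in `ℝ^(m+1)`. -/
def circularization (m : ℕ) (E : Set ℂ) : Set (Paravector m) :=
  {x | ∃ z ∈ E, ∃ I ∈ imUnits m, x = phi I z}

/-- Circular (axially symmetric) subsets of `ℝ^(m+1)`. -/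
def IsCircular {m : ℕ} (S : Set (Paravector m)) : Prop := ∃ E : Set ℂ, S = circularization m E

end Paravectors

section Functions

variable {m : ℕ}

/-- Functions of class `𝒞¹` on the open set `O`. As usual, a function on `O` is represented by a
function defined everywhere, of which only the values on `O` matter. -/
def classC1 (O : Set (Paravector m)) : Set (Paravector m → Rm m) := {f | ContDiffOn ℝ 1 f O}

/-- Functions that are real analytic on the open set `O`. -/
def classAnalytic (O : Set (Paravector m)) : Set (Paravector m → Rm m) :=
  {f | AnalyticOnNhd ℝ f O}

/-- The partial derivative `∂f/∂x_h`. -/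
def partialDeriv (h : Fin (m + 1)) (f : Paravector m → Rm m) (x : Paravector m) : Rm m :=
  fderiv ℝ f x (e m h)

/-- `½ (∂/∂α + I ∂/∂β)(f ∘ φ_I)` at the point `z = α + iβ`; that is, the value of
`∂̄_I f_I` at the point `φ_I(z)`. -/
def dbarI (I : Paravector m) (f : Paravector m → Rm m) (z : ℂ) : Rm m :=
  (1 / 2 : ℝ) • (fderiv ℝ (fun w => f (phi I w)) z 1
    + incl m I * fderiv ℝ (fun w => f (phi I w)) z Complex.I)

/-- The set of slice monogenic functions on `Ω`: the `𝒞¹` functions with `∂̄_I f_I = 0` on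
`Ω_I = {φ_I(z) : φ_I(z) ∈ Ω}` for every imaginary unit `I`. -/
def SM (Ω : Set (Paravector m)) : Set (Paravector m → Rm m) :=
  {f | f ∈ classC1 Ω ∧ ∀ I ∈ imUnits m, ∀ z : ℂ, phi I z ∈ Ω → dbarI I f z = 0}

/-- The operator `ϑ̄ₘ = ½ (∂/∂x₀ + Im(x)/|Im(x)|² ∑ₕ xₕ ∂/∂xₕ)`, off the real axis. -/
def thetaBar (g : Paravector m → Rm m) (x : Paravector m) : Rm m :=
  (1 / 2 : ℝ) • (partialDeriv 0 g x
    + incl m ((‖im x‖ ^ 2)⁻¹ • im x) * ∑ h : Fin m, x h.succ • partialDeriv h.succ g x)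

/-- The kernel of `ϑ̄ₘ : 𝒞¹(Ω_*) → 𝒞⁰(Ω_*)`, where `O = Ω_*`. -/
def kerThetaBar (O : Set (Paravector m)) : Set (Paravector m → Rm m) :=
  {g | g ∈ classC1 O ∧ ∀ x ∈ O, thetaBar g x = 0}

/-- The operator `Gₘ = |Im(x)|² ∂/∂x₀ + Im(x) ∑ₕ xₕ ∂/∂xₕ`. -/
def opG (f : Paravector m → Rm m) (x : Paravector m) : Rm m :=
  ‖im x‖ ^ 2 • partialDeriv 0 f x
    + incl m (im x) * ∑ h : Fin m, x h.succ • partialDeriv h.succ f x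

/-- The kernel of `Gₘ : 𝒞¹(Ω) → 𝒞⁰(Ω)`. -/
def kerG (Ω : Set (Paravector m)) : Set (Paravector m → Rm m) :=
  {f | f ∈ classC1 Ω ∧ ∀ x ∈ Ω, opG f x = 0}

end Functions

end SliceMono

end

/-! Off the real axis the three operators agree up to nonzero scalar factors: on the slice of `I`,
the sum of the `x_h ∂/∂x_h` is the derivative along Im(x) = βI. On the axis `opG` vanishes
identically, while the slice equation extends there by continuity. This gives the two equalities.
For analyticity, left multiplication by `I` is a complex structure on the algebra, so each slice
restriction is a vector-valued holomorphic function. The identity theorem, applied on slices that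
are connected because `Ω` meets ℝ, yields `SM.representation_formula`: one slice determines `f`. Off
the axis this formula exhibits `f` as a composition of analytic maps, since |Im(x)| is analytic
there. At a real point `t` the direction is singular, but averaging the slice power series by the
formula gives `f(t + y) = ∑ yⁿ aₙ` with products taken in the algebra, a series analytic in `y`. -/

noncomputable section

namespace SliceMono

/-! ### Holomorphic functions with values in a real space with a complex structure -/

section CauchyRiemann

open Complex Filter Topology

variable {V : Type*} [NormedAddCommGroup V] [NormedSpace ℝ V]

/-- The Cauchy-Riemann equation `∂u/∂β = J ∂u/∂α` on `D`, with respect to a complex structure `J`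
of the target space. -/
def CauchyRiemannOn (J : V →L[ℝ] V) (D : Set ℂ) (u : ℂ → V) : Prop :=
  ∀ z ∈ D, DifferentiableAt ℝ u z ∧ fderiv ℝ u z I = J (fderiv ℝ u z 1)

theorem CauchyRiemannOn.differentiableOn_comp {J : V →L[ℝ] V} {D : Set ℂ} {u : ℂ → V}
    (hu : CauchyRiemannOn J D u) {n : ℕ} (Ψ : V →L[ℝ] (Fin n → ℂ))
    (hΨ : ∀ v, Ψ (J v) = I • Ψ v) : DifferentiableOn ℂ (fun z => Ψ (u z)) D := by
  intro z hz
  obtain ⟨hd, hcr⟩ := hu z hz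
  have h : HasFDerivAt (fun z => Ψ (u z)) (Ψ.comp (fderiv ℝ u z)) z :=
    Ψ.hasFDerivAt.comp z hd.hasFDerivAt
  refine (differentiableAt_complex_iff_differentiableAt_real.2
    ⟨h.differentiableAt, ?_⟩).differentiableWithinAt
  rw [h.fderiv, ContinuousLinearMap.comp_apply, ContinuousLinearMap.comp_apply, hcr, hΨ]

variable [FiniteDimensional ℝ V]

/-- A finite-dimensional real space with a complex structure `J` is a retract of some `ℂⁿ`,
in such a way that `J` corresponds to the multiplication by `i`. -/
theorem exists_complex_retract (J : V →L[ℝ] V) (hJ : ∀ v, J (J v) = -v) :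
    ∃ (n : ℕ) (Ψ : V →L[ℝ] (Fin n → ℂ)) (P : (Fin n → ℂ) →L[ℝ] V),
      (∀ v, P (Ψ v) = v) ∧ (∀ v, Ψ (J v) = I • Ψ v) ∧ ∀ c, P (I • c) = J (P c) := by
  let b := Module.finBasis ℝ V
  let R : (Fin (Module.finrank ℝ V) → ℂ) →ₗ[ℝ] V :=
    b.equivFun.symm.toLinearMap ∘ₗ reLm.compLeft _
  let M : (Fin (Module.finrank ℝ V) → ℂ) →ₗ[ℝ] (Fin (Module.finrank ℝ V) → ℂ) :=
    { toFun := fun c => I • c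
      map_add' := fun x y => smul_add _ _ _
      map_smul' := fun r x => smul_comm _ _ _ }
  let T : V →ₗ[ℝ] (Fin (Module.finrank ℝ V) → ℂ) :=
    (Complex.ofRealCLM.toLinearMap).compLeft _ ∘ₗ b.equivFun.toLinearMap
  -- `Ψ v = T v - i T(J v)` is complex linear for `J`. Since `T` has real values, the real part of
  -- `Ψ v` recovers `v`; `P` averages `R` to make this left inverse complex linear too.
  let Ψ : V →ₗ[ℝ] (Fin (Module.finrank ℝ V) → ℂ) := T - M ∘ₗ T ∘ₗ J.toLinearMap
  let P : (Fin (Module.finrank ℝ V) → ℂ) →ₗ[ℝ] V :=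
    (1 / 2 : ℝ) • (R - J.toLinearMap ∘ₗ R ∘ₗ M)
  have hMM : ∀ c, M (M c) = -c := fun c => by
    change I • I • c = -c
    rw [smul_smul, I_mul_I, neg_one_smul]
  have hΨJ : ∀ v, Ψ (J v) = M (Ψ v) := fun v => by
    simp only [Ψ, LinearMap.sub_apply, LinearMap.comp_apply, ContinuousLinearMap.coe_coe, hJ,
      map_neg, map_sub, hMM]
    abel
  have hRΨ : ∀ v, R (Ψ v) = v := fun v => by
    simp only [R, Ψ, LinearMap.comp_apply, LinearEquiv.coe_coe]
    rw [LinearEquiv.symm_apply_eq]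
    ext i
    simp [M, T]
  have hPI : ∀ c, P (M c) = J (P c) := fun c => by
    simp only [P, LinearMap.sub_apply, LinearMap.smul_apply, LinearMap.comp_apply,
      ContinuousLinearMap.coe_coe, hJ, map_neg, map_sub, map_smul, hMM]
    congr 1
    abel
  have hPΨ : ∀ v, P (Ψ v) = v := fun v => by
    simp only [P, LinearMap.sub_apply, LinearMap.smul_apply, LinearMap.comp_apply,
      ContinuousLinearMap.coe_coe]
    rw [← hΨJ, hRΨ, hRΨ, hJ, sub_neg_eq_add, ← two_smul ℝ, smul_smul]
    norm_num
  exact ⟨_, LinearMap.toContinuousLinearMap Ψ, LinearMap.toContinuousLinearMap P, hPΨ, hΨJ, hPI⟩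

theorem CauchyRiemannOn.analyticAt {J : V →L[ℝ] V} (hJ : ∀ v, J (J v) = -v) {D : Set ℂ}
    (hD : IsOpen D) {u : ℂ → V} (hu : CauchyRiemannOn J D u) {z : ℂ} (hz : z ∈ D) :
    AnalyticAt ℝ u z := by
  obtain ⟨n, Ψ, P, hPΨ, hΨ, -⟩ := exists_complex_retract J hJ
  have h := ((hu.differentiableOn_comp Ψ hΨ).analyticAt (hD.mem_nhds hz)).restrictScalars (𝕜 := ℝ)
  have := (P.analyticAt (Ψ (u z))).comp_of_eq h rfl
  simpa only [Function.comp_def, hPΨ] using this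

theorem CauchyRiemannOn.eq_zero {J : V →L[ℝ] V} (hJ : ∀ v, J (J v) = -v) {D : Set ℂ}
    (hD : IsOpen D) (hDc : IsPreconnected D) {u : ℂ → V} (hu : CauchyRiemannOn J D u) {c : ℂ}
    (hc : c ∈ D) (hz : ∃ᶠ z in 𝓝[≠] c, u z = 0) {z : ℂ} (hzD : z ∈ D) : u z = 0 := by
  obtain ⟨n, Ψ, P, hPΨ, hΨ, -⟩ := exists_complex_retract J hJ
  have h := (analyticOnNhd_iff_differentiableOn hD).2 (hu.differentiableOn_comp Ψ hΨ)
  have h0 := h.eqOn_zero_of_preconnected_of_frequently_eq_zero hDc hc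
    (hz.mono fun z hz => by rw [hz, map_zero]) hzD
  rw [← hPΨ (u z), show Ψ (u z) = 0 from h0, map_zero]

/-- The Taylor series of `Ψ ∘ u` is carried back by `P`, which turns the scalar `wⁿ` into `Re wⁿ +
(Im wⁿ) J`. The bound on `a n` is kept so that the same coefficients can define a series in several
variables. -/
theorem CauchyRiemannOn.exists_hasSum {J : V →L[ℝ] V} (hJ : ∀ v, J (J v) = -v) {D : Set ℂ}
    (hD : IsOpen D) {u : ℂ → V} (hu : CauchyRiemannOn J D u) {c : ℂ} (hc : c ∈ D) :
    ∃ r > 0, ∃ (a : ℕ → V) (C : ℝ), (∀ n, ‖a n‖ * r ^ n ≤ C) ∧ ∀ w : ℂ, ‖w‖ < r →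
      HasSum (fun n => (w ^ n).re • a n + (w ^ n).im • J (a n)) (u (c + w)) := by
  obtain ⟨k, Ψ, P, hPΨ, hΨ, hP⟩ := exists_complex_retract J hJ
  obtain ⟨p, hp⟩ := (hu.differentiableOn_comp Ψ hΨ).analyticAt (hD.mem_nhds hc)
  obtain ⟨s, hs⟩ := hp
  obtain ⟨r, hr0, hrs⟩ := ENNReal.lt_iff_exists_nnreal_btwn.1 hs.r_pos
  have hr0' : 0 < (r : ℝ) := by exact_mod_cast hr0
  obtain ⟨C, hC0, hC⟩ := p.norm_mul_pow_le_of_lt_radius (hrs.trans_le hs.r_le)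
  refine ⟨r, hr0', fun n => P (p.coeff n), ‖P‖ * C, fun n => ?_, fun w hw => ?_⟩
  · calc ‖P (p.coeff n)‖ * (r : ℝ) ^ n ≤ (‖P‖ * ‖p n‖) * (r : ℝ) ^ n := by
          gcongr
          refine (P.le_opNorm _).trans ?_
          gcongr
          rw [p.norm_apply_eq_norm_coef]
      _ = ‖P‖ * (‖p n‖ * (r : ℝ) ^ n) := mul_assoc _ _ _
      _ ≤ ‖P‖ * C := by gcongr; exact hC n
  · have hmem : w ∈ Metric.eball (0 : ℂ) s := by
      rw [mem_eball_zero_iff]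
      refine lt_trans ?_ hrs
      rw [← ofReal_norm, ← ENNReal.ofReal_coe_nnreal]
      exact (ENNReal.ofReal_lt_ofReal_iff hr0').2 hw
    have h := P.hasSum (hs.hasSum hmem)
    rw [hPΨ] at h
    convert h using 2 with n
    simp only [FormalMultilinearSeries.apply_eq_pow_smul_coeff]
    conv_rhs => rw [← re_add_im (w ^ n), add_smul, mul_smul, map_add]
    rw [Complex.coe_smul, Complex.coe_smul, map_smul, map_smul, hP]

end CauchyRiemann

/-! ### Paravectors and imaginary units in the Clifford algebra -/

section Clifford

variable {m : ℕ}

instance (m : ℕ) : FiniteDimensional ℝ (Rm m) := (stdBasis m).finiteDimensional_of_finite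

/-- Multiplication of `ℝₘ` as a continuous bilinear map. -/
def mulL (m : ℕ) : Rm m →L[ℝ] Rm m →L[ℝ] Rm m :=
  LinearMap.toContinuousLinearMap
    ((LinearMap.toContinuousLinearMap (𝕜 := ℝ) (E := Rm m) (F' := Rm m)).toLinearMap ∘ₗ
      LinearMap.mul ℝ (Rm m))

@[simp]
theorem mulL_apply (a b : Rm m) : mulL m a b = a * b := rfl

theorem mulL_pow_apply (a b : Rm m) (n : ℕ) : (mulL m a ^ n) b = a ^ n * b := by
  induction n with
  | zero => simp
  | succ n ih => rw [pow_succ', mul_apply_eq_comp, ih, mulL_apply, pow_succ', mul_assoc]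

theorem incl_apply (x : Paravector m) :
    incl m x = algebraMap ℝ (Rm m) (x 0) + CliffordAlgebra.ι (negSq m) (fun j => x j.succ) := by
  have h : (fun j => x j.succ) = ∑ j : Fin m, x j.succ • (Pi.single j (1 : ℝ) : Fin m → ℝ) := by
    ext k
    simp [Finset.sum_apply, Pi.single_apply]
  rw [h, map_sum, Algebra.algebraMap_eq_smul_one]
  simp only [map_smul]
  rfl

@[simp]
theorem incl_e_zero : incl m (e m 0) = 1 := by
  simp [incl, e]

theorem negSq_apply (v : Fin m → ℝ) : negSq m v = -∑ j, v j ^ 2 := by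
  simp [negSq, QuadraticMap.weightedSumSquares_apply, sq]

theorem incl_sq (x : Paravector m) :
    incl m x ^ 2 = algebraMap ℝ (Rm m) (x 0 ^ 2 - ∑ j : Fin m, x j.succ ^ 2) +
      (2 * x 0) • CliffordAlgebra.ι (negSq m) (fun j => x j.succ) := by
  rw [incl_apply, sq, add_mul, mul_add, mul_add, CliffordAlgebra.ι_sq_scalar, negSq_apply,
    ← Algebra.commutes (x 0) (CliffordAlgebra.ι (negSq m) _), ← map_mul, ← Algebra.smul_def,
    sub_eq_add_neg, map_add, two_mul, add_smul, ← sq]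
  abel

theorem norm_sq_eq (x : Paravector m) : ‖x‖ ^ 2 = x 0 ^ 2 + ∑ j : Fin m, x j.succ ^ 2 := by
  rw [EuclideanSpace.norm_sq_eq, Fin.sum_univ_succ]
  simp

theorem mem_imUnits_iff {x : Paravector m} : x ∈ imUnits m ↔ x 0 = 0 ∧ ‖x‖ = 1 := by
  have hinj : Function.Injective (algebraMap ℝ (Rm m)) := (algebraMap ℝ (Rm m)).injective
  have hneg : (-1 : Rm m) = algebraMap ℝ (Rm m) (-1) := by rw [map_neg, map_one]
  constructor
  · intro hx
    have h1 : incl m x ^ 2 = -1 := hx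
    rw [incl_sq] at h1
    -- The grade involution fixes scalars and negates vectors, so the vector part `2 x₀ Im(x)` of
    -- the square must vanish.
    have h2 := congrArg (CliffordAlgebra.involute (Q := negSq m)) h1
    rw [map_add, AlgHom.commutes, map_smul, CliffordAlgebra.involute_ι, map_neg, map_one,
      ← h1, smul_neg, add_right_inj, neg_eq_iff_add_eq_zero, ← two_smul ℝ, smul_smul] at h2
    have h0 : x 0 = 0 := by
      by_contra h0
      have h3 : CliffordAlgebra.ι (negSq m) (fun j => x j.succ) = 0 :=
        (smul_eq_zero.1 h2).resolve_left (by simpa using h0)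
      have h4 := CliffordAlgebra.ι_sq_scalar (negSq m) (fun j => x j.succ)
      rw [h3, mul_zero, ← map_zero (algebraMap ℝ (Rm m)), negSq_apply] at h4
      have h5 := hinj h4
      rw [h3, smul_zero, add_zero, hneg] at h1
      have h6 := hinj h1
      nlinarith [sq_nonneg (x 0)]
    rw [h0, mul_zero, zero_smul, add_zero, hneg] at h1
    have h6 := hinj h1
    have h7 := norm_sq_eq x
    rw [h0] at h7
    refine ⟨h0, ?_⟩
    rw [← sq_eq_sq₀ (norm_nonneg _) zero_le_one]
    linarith
  · rintro ⟨h0, h1⟩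
    have h7 := norm_sq_eq x
    rw [h0, h1] at h7
    change incl m x ^ 2 = -1
    rw [incl_sq, h0, mul_zero, zero_smul, add_zero, hneg]
    congr 1
    linarith

theorem incl_mul_self {I : Paravector m} (hI : I ∈ imUnits m) : incl m I * incl m I = -1 :=
  (sq _).symm.trans hI

theorem neg_mem_imUnits {I : Paravector m} (hI : I ∈ imUnits m) : -I ∈ imUnits m := by
  rw [mem_imUnits_iff] at hI ⊢
  simpa using hI

theorem mulL_mulL {I : Paravector m} (hI : I ∈ imUnits m) (v : Rm m) :
    mulL m (incl m I) (mulL m (incl m I) v) = -v := by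
  rw [mulL_apply, mulL_apply, ← mul_assoc, incl_mul_self hI, neg_one_mul]

/-- Each slice is the image of an algebra homomorphism from ℂ, so powers of `phi I z` can be
computed in ℂ. -/
theorem incl_phi {I : Paravector m} (hI : I ∈ imUnits m) (z : ℂ) :
    incl m (phi I z) = Complex.liftAux (incl m I) (incl_mul_self hI) z := by
  rw [phi, map_add, map_smul, map_smul, incl_e_zero, Complex.liftAux_apply,
    Algebra.algebraMap_eq_smul_one]

end Clifford

/-! ### Slices and circular sets -/

section Geometry

variable {m : ℕ}

/-- The map `φ_I` as a continuous linear map. -/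
def phiL (I : Paravector m) : ℂ →L[ℝ] Paravector m :=
  Complex.reCLM.smulRight (e m 0) + Complex.imCLM.smulRight I

theorem phi_neg (I : Paravector m) (z : ℂ) : phi (-I) z = phi I (starRingEnd ℂ z) := by
  simp [phi]

theorem phi_ofReal (I : Paravector m) (t : ℝ) : phi I t = t • e m 0 := by
  simp [phi]

@[simp]
theorem im_apply_zero (x : Paravector m) : im x 0 = 0 := by
  simp [im, e]

theorem phi_apply_zero {I : Paravector m} (hI : I ∈ imUnits m) (z : ℂ) : phi I z 0 = z.re := by
  simp [phi, e, (mem_imUnits_iff.1 hI).1]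

theorem im_phi {I : Paravector m} (hI : I ∈ imUnits m) (z : ℂ) : im (phi I z) = z.im • I := by
  rw [im, phi_apply_zero hI, phi, add_sub_cancel_left]

theorem norm_im_phi {I : Paravector m} (hI : I ∈ imUnits m) (z : ℂ) :
    ‖im (phi I z)‖ = |z.im| := by
  rw [im_phi hI, norm_smul, (mem_imUnits_iff.1 hI).2, mul_one, Real.norm_eq_abs]

theorem im_eq_sum (x : Paravector m) : im x = ∑ h : Fin m, x h.succ • e m h.succ := by
  ext k
  refine Fin.cases ?_ (fun j => ?_) k
  · simp [e]
  · simp [im, e, Pi.single_apply, Finset.sum_apply]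

theorem mem_realAxis_iff {x : Paravector m} : x ∈ realAxis m ↔ im x = 0 := by
  constructor
  · rintro ⟨t, rfl⟩
    simp [im, e]
  · intro h
    exact ⟨x 0, (sub_eq_zero.1 h).symm⟩

/-- The map `x ↦ x₀ + i |Im(x)|` from paravectors to the closed upper half plane. -/
def modulus (x : Paravector m) : ℂ := ⟨x 0, ‖im x‖⟩

theorem continuous_im : Continuous (im : Paravector m → Paravector m) := by
  unfold im
  fun_prop

theorem continuous_modulus : Continuous (modulus : Paravector m → ℂ) := by
  have h : (modulus : Paravector m → ℂ) = fun x => (x 0 : ℂ) + (‖im x‖ : ℂ) * Complex.I := by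
    ext x
    simp [modulus, Complex.mk_eq_add_mul_I]
  have := continuous_im (m := m)
  rw [h]
  fun_prop

theorem modulus_phi {I : Paravector m} (hI : I ∈ imUnits m) {z : ℂ} (hz : 0 ≤ z.im) :
    modulus (phi I z) = z := by
  rw [modulus, phi_apply_zero hI, norm_im_phi hI, abs_of_nonneg hz]

/-- The imaginary unit `Im(x) / |Im(x)|`. -/
def direction (x : Paravector m) : Paravector m := ‖im x‖⁻¹ • im x

theorem direction_mem {x : Paravector m} (hx : im x ≠ 0) : direction x ∈ imUnits m := by
  rw [mem_imUnits_iff]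
  refine ⟨by simp [direction], ?_⟩
  rw [direction, norm_smul, norm_inv, norm_norm, inv_mul_cancel₀ (norm_ne_zero_iff.2 hx)]

theorem phi_direction {x : Paravector m} (hx : im x ≠ 0) : phi (direction x) (modulus x) = x := by
  rw [phi, modulus, direction, smul_smul, mul_inv_cancel₀ (norm_ne_zero_iff.2 hx), one_smul, im,
    add_sub_cancel]

theorem exists_eq_phi {J : Paravector m} (hJ : J ∈ imUnits m) (x : Paravector m) :
    ∃ I ∈ imUnits m, ∃ z, x = phi I z := by
  by_cases hx : im x = 0
  · obtain ⟨t, ht⟩ := mem_realAxis_iff.2 hx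
    exact ⟨J, hJ, t, by rw [phi_ofReal, ← ht]⟩
  · exact ⟨_, direction_mem hx, _, (phi_direction hx).symm⟩

theorem IsCircular.phi_mem {Ω : Set (Paravector m)} (hΩ : IsCircular Ω) {x : Paravector m}
    (hx : x ∈ Ω) {I : Paravector m} (hI : I ∈ imUnits m) {z : ℂ} (hre : z.re = x 0)
    (him : |z.im| = ‖im x‖) : phi I z ∈ Ω := by
  obtain ⟨E, rfl⟩ := hΩ
  obtain ⟨w, hw, K, hK, rfl⟩ := hx
  rw [phi_apply_zero hK] at hre
  rw [norm_im_phi hK] at him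
  rcases abs_eq_abs.1 him with h | h
  · exact ⟨w, hw, I, hI, by rw [phi, phi, hre, h]⟩
  · exact ⟨w, hw, -I, neg_mem_imUnits hI, by rw [phi, phi, hre, h, smul_neg, neg_smul]⟩

theorem IsCircular.phi_mem_phi {Ω : Set (Paravector m)} (hΩ : IsCircular Ω) {I J : Paravector m}
    (hI : I ∈ imUnits m) (hJ : J ∈ imUnits m) {z : ℂ} (h : phi I z ∈ Ω) : phi J z ∈ Ω :=
  hΩ.phi_mem h hJ (phi_apply_zero hI z).symm (norm_im_phi hI z).symm

/-- The slice is the union of the connected set `modulus '' Ω` and its complex conjugate; the two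
meet at a real point of `Ω`. -/
theorem IsCircular.isPreconnected_preimage {Ω : Set (Paravector m)} (hΩ : IsCircular Ω)
    (hc : IsPreconnected Ω) (hreal : (Ω ∩ realAxis m).Nonempty) {I : Paravector m}
    (hI : I ∈ imUnits m) : IsPreconnected (phi I ⁻¹' Ω) := by
  have h1 : IsPreconnected (modulus '' Ω) := hc.image _ continuous_modulus.continuousOn
  have h2 : IsPreconnected (starRingEnd ℂ '' (modulus '' Ω)) :=
    h1.image _ Complex.continuous_conj.continuousOn
  obtain ⟨x, hx, hxr⟩ := hreal
  have him := mem_realAxis_iff.1 hxr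
  have hconj : starRingEnd ℂ (modulus x) = modulus x := by
    rw [Complex.conj_eq_iff_im]
    simp [modulus, him]
  have h3 := IsPreconnected.union (modulus x) (Set.mem_image_of_mem _ hx)
    (⟨_, Set.mem_image_of_mem _ hx, hconj⟩ : modulus x ∈ starRingEnd ℂ '' (modulus '' Ω)) h1 h2
  convert h3 using 1
  ext z
  constructor
  · intro hz
    rcases le_total 0 z.im with h | h
    · exact Or.inl ⟨_, hz, modulus_phi hI h⟩
    · refine Or.inr ⟨starRingEnd ℂ z, ⟨phi (-I) z, hΩ.phi_mem_phi hI (neg_mem_imUnits hI) hz, ?_⟩,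
        Complex.conj_conj z⟩
      rw [phi_neg, modulus_phi hI (by simpa using h)]
  · rintro (⟨y, hy, rfl⟩ | ⟨_, ⟨y, hy, rfl⟩, rfl⟩)
    · exact hΩ.phi_mem hy hI rfl (abs_norm _)
    · exact hΩ.phi_mem hy hI (by simp [modulus]) (by simp [modulus])

end Geometry

/-! ### Comparison of the three operators -/

section Operators

open Filter Topology

variable {m : ℕ}

theorem fderiv_comp_phi {f : Paravector m → Rm m} {I : Paravector m} {z : ℂ}
    (hf : DifferentiableAt ℝ f (phi I z)) (w : ℂ) :
    fderiv ℝ (fun w => f (phi I w)) z w = fderiv ℝ f (phi I z) (phi I w) := by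
  have h : HasFDerivAt (fun w => f (phiL I w)) ((fderiv ℝ f (phi I z)).comp (phiL I)) z :=
    HasFDerivAt.comp (g := f) z hf.hasFDerivAt (phiL I).hasFDerivAt
  exact congrArg (fun T => T w) h.fderiv

theorem dbarI_eq {f : Paravector m → Rm m} {I : Paravector m} {z : ℂ}
    (hf : DifferentiableAt ℝ f (phi I z)) :
    dbarI I f z =
      (1 / 2 : ℝ) • (fderiv ℝ f (phi I z) (e m 0) + incl m I * fderiv ℝ f (phi I z) I) := by
  rw [dbarI, fderiv_comp_phi hf, fderiv_comp_phi hf]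
  simp [phi]

theorem sum_partialDeriv (f : Paravector m → Rm m) (x : Paravector m) :
    ∑ h : Fin m, x h.succ • partialDeriv h.succ f x = fderiv ℝ f x (im x) := by
  rw [im_eq_sum, map_sum]
  simp only [map_smul, partialDeriv]

theorem thetaBar_phi {f : Paravector m → Rm m} {I : Paravector m} (hI : I ∈ imUnits m) {z : ℂ}
    (hf : DifferentiableAt ℝ f (phi I z)) (hz : z.im ≠ 0) :
    thetaBar f (phi I z) = dbarI I f z := by
  rw [dbarI_eq hf, thetaBar, sum_partialDeriv, partialDeriv, norm_im_phi hI, im_phi hI, smul_smul,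
    map_smul, map_smul, smul_mul_smul_comm, sq_abs]
  rw [show (z.im ^ 2)⁻¹ * z.im * z.im = 1 by field_simp, one_smul]

theorem opG_eq_smul_thetaBar (f : Paravector m → Rm m) {x : Paravector m} (hx : im x ≠ 0) :
    opG f x = (2 * ‖im x‖ ^ 2) • thetaBar f x := by
  have h : ‖im x‖ ≠ 0 := norm_ne_zero_iff.2 hx
  rw [opG, thetaBar, smul_smul, smul_add, map_smul, smul_mul_assoc, smul_smul]
  congr 2
  · ring
  · rw [show 2 * ‖im x‖ ^ 2 * (1 / 2) * (‖im x‖ ^ 2)⁻¹ = 1 by field_simp, one_smul]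

theorem kerG_eq (Ω : Set (Paravector m)) :
    kerG Ω = {f | f ∈ classC1 Ω ∧ f ∈ kerThetaBar (Ω \ realAxis m)} := by
  ext f
  constructor
  · rintro ⟨hf, h⟩
    refine ⟨hf, hf.mono Set.sdiff_subset, fun x hx => ?_⟩
    have him : im x ≠ 0 := fun h => hx.2 (mem_realAxis_iff.2 h)
    have h1 := h x hx.1
    rw [opG_eq_smul_thetaBar f him] at h1
    exact (smul_eq_zero.1 h1).resolve_left (by simpa using him)
  · rintro ⟨hf, -, h⟩
    refine ⟨hf, fun x hx => ?_⟩
    by_cases him : im x = 0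
    · simp [opG, him]
    · rw [opG_eq_smul_thetaBar f him, h x ⟨hx, fun h => him (mem_realAxis_iff.1 h)⟩, smul_zero]

theorem classC1.differentiableAt {Ω : Set (Paravector m)} (hΩ : IsOpen Ω)
    {f : Paravector m → Rm m} (hf : f ∈ classC1 Ω) {x : Paravector m} (hx : x ∈ Ω) :
    DifferentiableAt ℝ f x :=
  (ContDiffOn.contDiffAt hf (hΩ.mem_nhds hx)).differentiableAt one_ne_zero

theorem continuousOn_dbarI {Ω : Set (Paravector m)} (hΩ : IsOpen Ω) {f : Paravector m → Rm m}
    (hf : f ∈ classC1 Ω) (I : Paravector m) : ContinuousOn (dbarI I f) (phi I ⁻¹' Ω) := by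
  have h1 : ContinuousOn (fun z => fderiv ℝ f (phi I z)) (phi I ⁻¹' Ω) :=
    (ContDiffOn.continuousOn_fderiv_of_isOpen hf hΩ le_rfl).comp
      (phiL I).continuous.continuousOn fun z hz => hz
  have h2 : ContinuousOn (fun z => (1 / 2 : ℝ) • (fderiv ℝ f (phi I z) (e m 0) +
      mulL m (incl m I) (fderiv ℝ f (phi I z) I))) (phi I ⁻¹' Ω) := by
    fun_prop
  exact h2.congr fun z hz => dbarI_eq (classC1.differentiableAt hΩ hf hz)

theorem SM_eq_kerThetaBar {Ω : Set (Paravector m)} (hΩ : IsOpen Ω) :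
    SM Ω = {f | f ∈ classC1 Ω ∧ f ∈ kerThetaBar (Ω \ realAxis m)} := by
  ext f
  constructor
  · rintro ⟨hf, h⟩
    refine ⟨hf, hf.mono Set.sdiff_subset, fun x hx => ?_⟩
    have him : im x ≠ 0 := fun h => hx.2 (mem_realAxis_iff.2 h)
    have hx' : phi (direction x) (modulus x) ∈ Ω := by rw [phi_direction him]; exact hx.1
    rw [← phi_direction him, thetaBar_phi (direction_mem him)
      (classC1.differentiableAt hΩ hf hx') (by simpa [modulus] using him)]
    exact h _ (direction_mem him) _ hx'
  · rintro ⟨hf, -, h⟩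
    refine ⟨hf, fun I hI z hz => ?_⟩
    have hoff : ∀ w, phi I w ∈ Ω → w.im ≠ 0 → dbarI I f w = 0 := fun w hw hw0 => by
      rw [← thetaBar_phi hI (classC1.differentiableAt hΩ hf hw) hw0]
      refine h _ ⟨hw, fun hr => hw0 ?_⟩
      rw [← abs_eq_zero, ← norm_im_phi hI, mem_realAxis_iff.1 hr, norm_zero]
    by_contra hne
    have hD : IsOpen (phi I ⁻¹' Ω) := hΩ.preimage (phiL I).continuous
    have hev : ∀ᶠ w in 𝓝 z, phi I w ∈ Ω ∧ dbarI I f w ≠ 0 :=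
      Eventually.and (hD.mem_nhds hz)
        (((continuousOn_dbarI hΩ hf I).continuousAt (hD.mem_nhds hz)).eventually_ne hne)
    have hz0 : z.im = 0 := by
      by_contra h0
      exact hne (hoff z hz h0)
    -- A real `z` is approached vertically through nonreal points, where `dbarI` vanishes; this
    -- contradicts its being nonzero near `z`.
    have ht : Tendsto (fun t : ℝ => z + t * Complex.I) (𝓝[≠] 0) (𝓝 z) := by
      refine Tendsto.mono_left ?_ nhdsWithin_le_nhds
      have : Continuous fun t : ℝ => z + t * Complex.I := by fun_prop
      simpa using this.tendsto 0
    obtain ⟨t, ht1, ht0⟩ := ((ht.eventually hev).and self_mem_nhdsWithin).exists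
    exact ht1.2 (hoff _ ht1.1 (by simpa [hz0] using ht0))

end Operators

/-! ### Power series in a noncommuting operator variable -/

section PowerSeries

open Filter Topology

/-- A power series in an operator `T y` depending linearly on `y`, applied to vectors `a n` of at
most geometric growth, is analytic at `0`. -/
theorem analyticAt_of_hasSum_pow_apply {E V : Type*} [NormedAddCommGroup E] [NormedSpace ℝ E]
    [NormedAddCommGroup V] [NormedSpace ℝ V] [CompleteSpace V] (T : E →L[ℝ] V →L[ℝ] V)
    {a : ℕ → V} {r C : ℝ} (hr : 0 < r) (ha : ∀ n, ‖a n‖ * r ^ n ≤ C) {g : E → V}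
    (hg : ∀ᶠ y in 𝓝 0, HasSum (fun n => (T y ^ n) (a n)) (g y)) : AnalyticAt ℝ g 0 := by
  -- The `n`-th term is `(S₁, …, Sₙ) ↦ (S₁ ⋯ Sₙ)(a n)`, whose diagonal is `Sⁿ (a n)`.
  let p : FormalMultilinearSeries ℝ (V →L[ℝ] V) V := fun n =>
    (ContinuousLinearMap.apply ℝ V (a n)).compContinuousMultilinearMap
      (ContinuousMultilinearMap.mkPiAlgebraFin ℝ n (V →L[ℝ] V))
  have hpn : ∀ n, ‖p n‖ ≤ ‖a n‖ := fun n => by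
    refine (ContinuousLinearMap.norm_compContinuousMultilinearMap_le _ _).trans ?_
    have h1 : ‖ContinuousLinearMap.apply ℝ V (a n)‖ ≤ ‖a n‖ :=
      ContinuousLinearMap.opNorm_le_bound _ (norm_nonneg _) fun S =>
        (S.le_opNorm _).trans_eq (mul_comm _ _)
    have h2 : ‖ContinuousMultilinearMap.mkPiAlgebraFin ℝ n (V →L[ℝ] V)‖ ≤ 1 :=
      ContinuousMultilinearMap.norm_mkPiAlgebraFin_le.trans
        (max_le le_rfl ContinuousLinearMap.norm_id_le)
    calc _ ≤ ‖a n‖ * 1 := by gcongr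
      _ = ‖a n‖ := mul_one _
  lift r to NNReal using hr.le
  have hrad : (r : ENNReal) ≤ p.radius := p.le_radius_of_bound C fun n =>
    (mul_le_mul_of_nonneg_right (hpn n) (by positivity)).trans (ha n)
  have hpos : 0 < p.radius := lt_of_lt_of_le (by exact_mod_cast hr) hrad
  have hp := (p.hasFPowerSeriesOnBall hpos).analyticAt
  have hcomp : AnalyticAt ℝ (fun y => p.sum (T y)) 0 :=
    hp.comp_of_eq (T.analyticAt 0) (map_zero T)
  refine hcomp.congr ?_
  filter_upwards [hg] with y hy
  rw [← hy.tsum_eq]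
  refine tsum_congr fun n => ?_
  simp [p]

end PowerSeries

/-! ### Representation formula and real analyticity -/

section Analyticity

open Filter Topology

variable {m : ℕ} {Ω : Set (Paravector m)} {f : Paravector m → Rm m}

theorem SM.cauchyRiemannOn (hΩ : IsOpen Ω) (hf : f ∈ SM Ω) {I : Paravector m}
    (hI : I ∈ imUnits m) :
    CauchyRiemannOn (mulL m (incl m I)) (phi I ⁻¹' Ω) fun z => f (phi I z) := by
  intro z hz
  have hd := classC1.differentiableAt hΩ hf.1 hz
  refine ⟨DifferentiableAt.comp (g := f) z hd (phiL I).differentiableAt, ?_⟩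
  have h := (smul_eq_zero.1 (hf.2 I hI z hz)).resolve_left (by norm_num)
  rw [eq_neg_of_add_eq_zero_left h, map_neg, ← mulL_apply, mulL_mulL hI, neg_neg]

/-- The right hand side of the representation formula, which expresses the values of a slice
monogenic function on the slice of `I` by those on the slice of `J`. -/
def representation (J : Paravector m) (u : ℂ → Rm m) (I : Paravector m) (z : ℂ) : Rm m :=
  (1 / 2 : ℝ) • ((u z + u (starRingEnd ℂ z)) -
    mulL m (incl m I) (mulL m (incl m J) (u z - u (starRingEnd ℂ z))))

/-- Let `s` and `d` be the sum and difference of `u(z)` and `u(z̄)`. Conjugation reverses `∂/∂β`, so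
`∂s/∂β = J ∂d/∂α` and `∂d/∂β = J ∂s/∂α`; hence `s - IJd` satisfies the equation for `I`. -/
theorem cauchyRiemannOn_representation {D : Set ℂ} (hD : ∀ z ∈ D, starRingEnd ℂ z ∈ D)
    {I J : Paravector m} (hI : I ∈ imUnits m) (hJ : J ∈ imUnits m) {u : ℂ → Rm m}
    (hu : CauchyRiemannOn (mulL m (incl m J)) D u) :
    CauchyRiemannOn (mulL m (incl m I)) D (representation J u I) := by
  intro z hz
  obtain ⟨h1, h2⟩ := hu z hz
  obtain ⟨h3, h4⟩ := hu _ (hD z hz)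
  have h5 : HasFDerivAt (fun w => u (starRingEnd ℂ w))
      ((fderiv ℝ u (starRingEnd ℂ z)).comp (Complex.conjCLE : ℂ →L[ℝ] ℂ)) z :=
    HasFDerivAt.comp (g := u) z h3.hasFDerivAt Complex.conjCLE.hasFDerivAt
  have h6 := ((h1.hasFDerivAt.add h5).sub
    (((mulL m (incl m I)).comp (mulL m (incl m J))).hasFDerivAt.comp z
      (h1.hasFDerivAt.sub h5))).const_smul (1 / 2 : ℝ)
  have h7 : HasFDerivAt (representation J u I) _ z := h6
  refine ⟨h7.differentiableAt, ?_⟩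
  rw [h7.fderiv]
  have hIv := mulL_mulL hI
  have hJv := mulL_mulL hJ
  simp only [smul_apply, sub_apply,
    add_apply, ContinuousLinearMap.comp_apply, ContinuousLinearEquiv.coe_coe,
    Complex.conjCLE_apply, Complex.conj_I, map_one, map_neg, map_sub, map_add, map_smul, h2, h4,
    hIv, hJv]
  congr 1
  abel

/-- Both sides solve the Cauchy-Riemann equation for `I` and agree at real points, where `z = z̄`.
Such points accumulate in the connected slice, so the identity theorem applies. -/
theorem SM.representation_formula (hΩ : IsOpen Ω) (hc : IsPreconnected Ω) (hcirc : IsCircular Ω)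
    (hreal : (Ω ∩ realAxis m).Nonempty) (hf : f ∈ SM Ω) {I J : Paravector m}
    (hI : I ∈ imUnits m) (hJ : J ∈ imUnits m) {z : ℂ} (hz : phi I z ∈ Ω) :
    f (phi I z) = representation J (fun w => f (phi J w)) I z := by
  have hD : phi J ⁻¹' Ω = phi I ⁻¹' Ω :=
    Set.ext fun w => ⟨hcirc.phi_mem_phi hJ hI, hcirc.phi_mem_phi hI hJ⟩
  have hconj : ∀ w ∈ phi I ⁻¹' Ω, starRingEnd ℂ w ∈ phi I ⁻¹' Ω := fun w hw => by
    rw [Set.mem_preimage, ← phi_neg]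
    exact hcirc.phi_mem_phi hI (neg_mem_imUnits hI) hw
  have hu := SM.cauchyRiemannOn hΩ hf hJ
  rw [hD] at hu
  have h1 := SM.cauchyRiemannOn hΩ hf hI
  have h2 := cauchyRiemannOn_representation hconj hI hJ hu
  have hopen : IsOpen (phi I ⁻¹' Ω) := hΩ.preimage (phiL I).continuous
  have h3 : CauchyRiemannOn (mulL m (incl m I)) (phi I ⁻¹' Ω)
      fun w => f (phi I w) - representation J (fun w => f (phi J w)) I w := fun w hw => by
    refine ⟨(h1 w hw).1.fun_sub (h2 w hw).1, ?_⟩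
    rw [fderiv_fun_sub (h1 w hw).1 (h2 w hw).1, sub_apply,
      sub_apply, map_sub, (h1 w hw).2, (h2 w hw).2]
  obtain ⟨_, hx, t, rfl⟩ := hreal
  have ht : (t : ℂ) ∈ phi I ⁻¹' Ω := by
    rw [Set.mem_preimage, phi_ofReal]
    exact hx
  refine sub_eq_zero.1 (h3.eq_zero (mulL_mulL hI) hopen
    (hcirc.isPreconnected_preimage hc ⟨_, hx, t, rfl⟩ hI) ht ?_ hz)
  have htend : Tendsto (fun s : ℝ => (s : ℂ)) (𝓝[≠] t) (𝓝[≠] (t : ℂ)) :=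
    Complex.continuous_ofReal.continuousAt.tendsto.inf
      (tendsto_principal_principal.2 fun s hs => by simpa using hs)
  refine htend.frequently (Eventually.of_forall fun s => ?_).frequently
  simp only [representation, Complex.conj_ofReal, phi_ofReal, sub_self, map_zero, sub_zero,
    ← two_smul ℝ (f _), smul_smul]
  norm_num

/-- The representation formula for the functions `w ↦ φ_J(w)ⁿ a`. -/
theorem representation_pow {I J : Paravector m} (hI : I ∈ imUnits m) (hJ : J ∈ imUnits m)
    (n : ℕ) (a : Rm m) (w : ℂ) :
    representation J (fun w => (w ^ n).re • a + (w ^ n).im • mulL m (incl m J) a) I w =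
      (mulL m (incl m (phi I w)) ^ n) a := by
  rw [mulL_pow_apply, incl_phi hI, ← map_pow, Complex.liftAux_apply, add_mul,
    ← Algebra.smul_def, smul_mul_assoc, ← mulL_apply (incl m I)]
  have hJv := mulL_mulL hJ
  simp only [representation, ← map_pow (starRingEnd ℂ), Complex.conj_re, Complex.conj_im, map_sub,
    map_add, map_smul, hJv, map_neg, neg_smul, smul_neg]
  module

theorem SM.analyticAt_of_im_ne_zero (hΩ : IsOpen Ω) (hc : IsPreconnected Ω)
    (hcirc : IsCircular Ω) (hreal : (Ω ∩ realAxis m).Nonempty) (hf : f ∈ SM Ω)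
    {x : Paravector m} (hx : x ∈ Ω) (him : im x ≠ 0) : AnalyticAt ℝ f x := by
  have hJ := direction_mem him
  -- `J` stays fixed at the direction of `x`, while the unit and `modulus` in the representation
  -- vary analytically with `y`.
  set J := direction x
  have hu := SM.cauchyRiemannOn hΩ hf hJ
  have hopen : IsOpen (phi J ⁻¹' Ω) := hΩ.preimage (phiL J).continuous
  have hmem : modulus x ∈ phi J ⁻¹' Ω := hcirc.phi_mem hx hJ rfl (abs_norm _)
  have hmem' : starRingEnd ℂ (modulus x) ∈ phi J ⁻¹' Ω :=
    hcirc.phi_mem hx hJ (by simp [modulus]) (by simp [modulus])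
  have h1 := (hu.analyticAt (mulL_mulL hJ) hopen hmem).contDiffAt (n := ω)
  have h2 := (hu.analyticAt (mulL_mulL hJ) hopen hmem').contDiffAt (n := ω)
  have him' : ContDiffAt ℝ ω (im : Paravector m → Paravector m) x := by
    unfold im
    fun_prop
  have hnorm : ContDiffAt ℝ ω (fun y : Paravector m => ‖im y‖) x := him'.norm ℝ him
  have hmod : ContDiffAt ℝ ω (modulus : Paravector m → ℂ) x := by
    have h : (modulus : Paravector m → ℂ) =
        fun y => Complex.equivRealProdCLM.symm (y 0, ‖im y‖) := rfl
    rw [h]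
    fun_prop
  have hdir : ContDiffAt ℝ ω (direction : Paravector m → Paravector m) x :=
    (hnorm.inv (norm_ne_zero_iff.2 him)).smul him'
  have hincl : ContDiffAt ℝ ω (fun y => mulL m (incl m (direction y))) x := by
    have h := ((mulL m).comp (LinearMap.toContinuousLinearMap (incl m))).contDiff (n := ω)
    exact h.contDiffAt.comp x hdir
  have h3 : ContDiffAt ℝ ω (fun y => f (phi J (modulus y))) x :=
    ContDiffAt.comp (g := fun z => f (phi J z)) x h1 hmod
  have h4 : ContDiffAt ℝ ω (fun y => f (phi J (starRingEnd ℂ (modulus y)))) x :=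
    ContDiffAt.comp (g := fun z => f (phi J z)) x h2
      (Complex.conjCLE.contDiff.contDiffAt.comp x hmod)
  have h5 : ContDiffAt ℝ ω
      (fun y => representation J (fun w => f (phi J w)) (direction y) (modulus y)) x := by
    unfold representation
    exact ((h3.add h4).sub (hincl.clm_apply
      ((mulL m (incl m J)).contDiff.contDiffAt.comp x (h3.sub h4)))).const_smul _
  refine (h5.congr_of_eventuallyEq ?_).analyticAt
  have hne : ∀ᶠ y in 𝓝 x, im y ≠ 0 := continuous_im.continuousAt.eventually_ne him
  filter_upwards [hne, hΩ.mem_nhds hx] with y hy hyΩ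
  have hyΩ' : phi (direction y) (modulus y) ∈ Ω := by rwa [phi_direction hy]
  rw [← SM.representation_formula hΩ hc hcirc hreal hf (direction_mem hy) hJ hyΩ',
    phi_direction hy]

theorem SM.analyticAt_of_im_eq_zero (hΩ : IsOpen Ω) (hc : IsPreconnected Ω)
    (hcirc : IsCircular Ω) (hreal : (Ω ∩ realAxis m).Nonempty) (hf : f ∈ SM Ω)
    {x : Paravector m} (hx : x ∈ Ω) (him : im x = 0) : AnalyticAt ℝ f x := by
  -- A real point has no direction of its own; a unit comes from writing `x` as a point of a
  -- circularization.
  obtain ⟨J, hJ⟩ : ∃ J, J ∈ imUnits m := by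
    obtain ⟨E, rfl⟩ := hcirc
    obtain ⟨_, _, J, hJ, _⟩ := hx
    exact ⟨J, hJ⟩
  obtain ⟨t, rfl⟩ := mem_realAxis_iff.2 him
  have hu := SM.cauchyRiemannOn hΩ hf hJ
  have hopen : IsOpen (phi J ⁻¹' Ω) := hΩ.preimage (phiL J).continuous
  have ht : (t : ℂ) ∈ phi J ⁻¹' Ω := by
    rw [Set.mem_preimage, phi_ofReal]
    exact hx
  obtain ⟨r, hr, a, C, hC, hsum⟩ := hu.exists_hasSum (mulL_mulL hJ) hopen ht
  have hadd : ∀ (I : Paravector m) (w : ℂ), phi I (t + w) = t • e m 0 + phi I w := fun I w => by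
    rw [← phi_ofReal I t]
    exact map_add (phiL I) _ _
  have key : AnalyticAt ℝ (fun y => f (t • e m 0 + y)) 0 := by
    refine analyticAt_of_hasSum_pow_apply
      ((mulL m).comp (LinearMap.toContinuousLinearMap (incl m))) hr hC ?_
    have h1 : ∀ᶠ y in 𝓝 (0 : Paravector m), t • e m 0 + y ∈ Ω :=
      (continuous_const.add continuous_id).continuousAt.eventually_mem
        (hΩ.mem_nhds (by simpa using hx))
    have h2 : ∀ᶠ y in 𝓝 (0 : Paravector m), ‖modulus y‖ < r := by
      refine continuous_modulus.norm.continuousAt.eventually_lt continuousAt_const ?_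
      have : modulus (0 : Paravector m) = 0 := by simp [modulus, im, Complex.ext_iff]
      rwa [this, norm_zero]
    filter_upwards [h1, h2] with y hy hyr
    obtain ⟨I, hI, w, rfl⟩ := exists_eq_phi hJ y
    have hwr : ‖w‖ < r := by
      have h3 : ‖modulus (phi I w)‖ = ‖w‖ := by
        rw [← sq_eq_sq₀ (norm_nonneg _) (norm_nonneg _), Complex.sq_norm, Complex.sq_norm,
          Complex.normSq_apply, Complex.normSq_apply]
        simp [modulus, phi_apply_zero hI, norm_im_phi hI]
      rwa [← h3]
    have hs1 := hsum w hwr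
    have hs2 := hsum (starRingEnd ℂ w) (by rwa [Complex.norm_conj])
    -- The representation formula is applied termwise to the series at `w` and `w̄`; by
    -- `representation_pow` each term becomes `phi I w ^ n * a n`, which no longer involves `J`.
    have hs := ((hs1.add hs2).sub (((mulL m (incl m I)).comp (mulL m (incl m J))).hasSum
      (hs1.sub hs2))).const_smul (1 / 2 : ℝ)
    have hval : f (t • e m 0 + phi I w) =
        representation J (fun w => f (phi J (t + w))) I w := by
      rw [← hadd, SM.representation_formula hΩ hc hcirc hreal hf hI hJ (by rwa [hadd])]
      simp [representation]
    rw [hval]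
    refine hs.congr_fun fun n => ?_
    exact (representation_pow hI hJ n (a n) w).symm
  have h := key.comp_of_eq (analyticAt_id.sub (analyticAt_const (v := t • e m 0))
    (x := t • e m 0)) (by simp)
  simpa [Function.comp_def] using h

theorem SM.analyticOnNhd (hΩ : IsOpen Ω) (hc : IsPreconnected Ω) (hcirc : IsCircular Ω)
    (hreal : (Ω ∩ realAxis m).Nonempty) (hf : f ∈ SM Ω) : AnalyticOnNhd ℝ f Ω := fun x hx => by
  by_cases him : im x = 0
  · exact SM.analyticAt_of_im_eq_zero hΩ hc hcirc hreal hf hx him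
  · exact SM.analyticAt_of_im_ne_zero hΩ hc hcirc hreal hf hx him

end Analyticity

end SliceMono

end

theorem mainTheorem9 (m : ℕ) (hm : 2 ≤ m) (Ω : Set (SliceMono.Paravector m))
    (hopen : IsOpen Ω) (hconn : IsConnected Ω) (hcirc : SliceMono.IsCircular Ω)
    (hreal : (Ω ∩ SliceMono.realAxis m).Nonempty) :
    SliceMono.SM Ω =
        {f | f ∈ SliceMono.classC1 Ω ∧ f ∈ SliceMono.kerThetaBar (Ω \ SliceMono.realAxis m)} ∧
      SliceMono.SM Ω = SliceMono.kerG Ω ∧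
      SliceMono.SM Ω ⊆ SliceMono.classAnalytic Ω := by
  refine ⟨SliceMono.SM_eq_kerThetaBar hopen, ?_, fun f hf =>
    SliceMono.SM.analyticOnNhd hopen hconn.isPreconnected hcirc hreal hf⟩
  rw [SliceMono.SM_eq_kerThetaBar hopen, SliceMono.kerG_eq]
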